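/- A $p$-string of length $s$ is a valid string of $s$ pairs of parentheses; there are $C_s=\frac1{s+1}\binom{2s}{s}$ of them. For $s\ge 1$, two $p$-strings $P,Q$ of length $s$ generate a $(1,2s-1)$-meander graph, a $4$-valent plane multigraph, as follows. The axis is the segment $[0,2s]$ of the $x$-axis and the vertices are its points $1,\dots,2s-1$. Place the letters of $P$ at the points $1,\dots,2s$ and draw, for each matched pair of parentheses, a semicircle above the axis joining the two corresponding points; place the letters of $Q$ at the points $0,\dots,2s-1$ and draw likewise semicircles below the axis. The edges are the semicircles and the segments $[i,i+1]$, $1\le i\le 2s-2$, of the axis, where the segment $[0,1]$ (respectively $[2s-1,2s]$) is joined to the semicircle ending at $0$ (respectively $2s$) to form a single edge, possibly a loop. Meander graphs are considered as drawn in the plane, so that two of them are equal if and only if they have the same upper and the same lower semicircles. A pierced circle at position $i$, $1\le i\le 2s-2$, is the circle formed by an upper and a lower semicircle which both join the consecutive vertices $i$ and $i+1$. Let $E(s,k)$ be the number of $(1,2s-1)$-meander graphs with exactly $k$ pierced circles. **Proposition.** The ratio of the number of $(1,2s-1)$-meander graphs without any pierced circle to the number of all $(1,2s-1)$-meander graphs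 tends to zero, i.e. $$\frac{E(s,0)}{C_s^2}\longrightarrow 0\qquad\text{as } s\to\infty .$$ -/

import Mathlib

/-- The `i`-th and `j`-th letters (counted from `0`) of the parenthesis string `p` form a matched
pair of parentheses: the string between them is itself a valid parenthesis string. -/
def ParenMatched (p : DyckWord) (i j : ℕ) : Prop :=
  ∃ (l r : List DyckStep) (q : DyckWord),
    p.toList = l ++ q.nest.toList ++ r ∧ i = l.length ∧ j = i + q.toList.length + 1

/-- Labels of the edges of a meander graph, recording how they are drawn in the plane. The axis is
the segment from `0` to `2 * s` of the `x`-axis.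
* `axis i` is the segment of the axis from `i` to `i + 1`.
* `upper a b` contains the semicircle above the axis with ends `a` and `b`.
* `lower a b` contains the semicircle below the axis with ends `a` and `b`. -/
inductive MeanderEdge
  | axis (i : ℕ)
  | upper (a b : ℕ)
  | lower (a b : ℕ)

namespace MeanderEdge

/-- The vertices are the points `1, …, 2 * s - 1` of the axis. The leftmost segment `[0, 1]` and
the rightmost segment `[2 * s - 1, 2 * s]` of the axis belong to the same edge as the semicircle
that ends at `0`, respectively at `2 * s`; so such an edge ends at the vertex `1`, respectively
`2 * s - 1`. -/
def toVertex (s x : ℕ) : ℕ := max 1 (min x (2 * s - 1))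

/-- The unordered pair of the two ends of an edge (they may coincide). -/
def ends (s : ℕ) : MeanderEdge → Sym2 ℕ
  | axis i => s(i, i + 1)
  | upper a b => s(toVertex s a, toVertex s b)
  | lower a b => s(toVertex s a, toVertex s b)

/-- The edges of the meander graph given by two parenthesis strings `P`, `Q` with `s` pairs each:
the letters of `P` are placed at the points `1, …, 2 * s` above the axis and the letters of `Q` at
the points `0, …, 2 * s - 1` below it, and every matched pair gives a semicircle. -/
def IsEdgeOf (s : ℕ) (P Q : DyckWord) : MeanderEdge → Prop
  | axis i => 1 ≤ i ∧ i + 1 < 2 * s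
  | upper a b => ∃ i j, ParenMatched P i j ∧ a = i + 1 ∧ b = j + 1
  | lower a b => ParenMatched Q a b

end MeanderEdge

theorem ParenMatched.semilength_pos {p : DyckWord} {i j : ℕ} (h : ParenMatched p i j) :
    0 < p.semilength := by
  obtain ⟨l, r, q, h, -, -⟩ := h
  have h1 := congrArg List.length h
  have h2 := DyckWord.two_mul_semilength_eq_length (p := q.nest)
  have h3 := DyckWord.two_mul_semilength_eq_length (p := p)
  rw [DyckWord.semilength_nest] at h2
  simp only [List.length_append] at h1
  omega

theorem MeanderEdge.ends_mem {s : ℕ} {P Q : DyckWord} (hP : P.semilength = s)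
    (hQ : Q.semilength = s) {e : MeanderEdge} (he : e.IsEdgeOf s P Q) {x : ℕ}
    (hx : x ∈ e.ends s) : 1 ≤ x ∧ x < 2 * s := by
  cases e with
  | axis i =>
    simp only [MeanderEdge.IsEdgeOf, MeanderEdge.ends, Sym2.mem_iff] at he hx
    omega
  | upper a b =>
    obtain ⟨i, j, h, -, -⟩ := he
    have := h.semilength_pos
    simp only [MeanderEdge.ends, Sym2.mem_iff, MeanderEdge.toVertex] at hx
    omega
  | lower a b =>
    have := ParenMatched.semilength_pos he
    simp only [MeanderEdge.ends, Sym2.mem_iff, MeanderEdge.toVertex] at hx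
    omega

/-- The meander graph generated by two parenthesis strings `P` (upper) and `Q` (lower) with `s`
pairs of parentheses each. -/
def meanderGraph (s : ℕ) (P Q : {p : DyckWord // p.semilength = s}) : Graph ℕ MeanderEdge where
  vertexSet := {x | 1 ≤ x ∧ x < 2 * s}
  IsLink e x y := e.IsEdgeOf s P Q ∧ s(x, y) = e.ends s
  isLink_symm _ _ := ⟨fun _ _ h => ⟨h.1, Sym2.eq_swap.trans h.2⟩⟩
  eq_or_eq_of_isLink_of_isLink _ _ _ _ _ h h' := by
    have := Sym2.eq_iff.1 (h.2.trans h'.2.symm)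
    tauto
  left_mem_of_isLink _ _ _ h :=
    MeanderEdge.ends_mem P.2 Q.2 h.1 (h.2 ▸ Sym2.mem_mk_left _ _)

/-- The set of all `(1, 2 * s - 1)`-meander graphs. -/
def meanderGraphs (s : ℕ) : Set (Graph ℕ MeanderEdge) :=
  {Γ | ∃ P Q, Γ = meanderGraph s P Q}

/-- There is a pierced circle at position `i`: the consecutive vertices `i` and `i + 1` are
joined by a semicircle above the axis and by a semicircle below the axis. -/
def HasPiercedCircleAt (Γ : Graph ℕ MeanderEdge) (i : ℕ) : Prop :=
  Γ.IsLink (.upper i (i + 1)) i (i + 1) ∧ Γ.IsLink (.lower i (i + 1)) i (i + 1)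

/-- The number of pierced circles of a meander graph. -/
noncomputable def numPiercedCircles (Γ : Graph ℕ MeanderEdge) : ℕ :=
  {i | HasPiercedCircleAt Γ i}.ncard

/-- `E(s, k)`, the number of `(1, 2 * s - 1)`-meander graphs with exactly `k` pierced circles. -/
noncomputable def meanderE (s k : ℕ) : ℕ :=
  {Γ ∈ meanderGraphs s | numPiercedCircles Γ = k}.ncard

/-!
A pierced circle at position `i + 1` amounts to a peak `UD` of the upper string at position `i`
and a peak of the lower string at position `i + 1`. Inserting a peak at a prescribed place is a
bijection, so a prescribed peak has probability `C_{s-1} / C_s → 1/4` and two prescribed disjoint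
peaks have probability `C_{s-2} / C_s → 1/16`. Hence the `2s - 2` events of a pierced circle at `i`
all have the same probability and are pairwise asymptotically uncorrelated (or exclusive, at
adjacent positions), and by the second moment method one of them occurs with probability tending
to one.
-/

open Filter Finset DyckStep

section SecondMoment

variable {α ι : Type*} [DecidableEq α]

/-- The Chung–Erdős inequality for the uniform measure. -/
theorem sq_sum_card_le_card_biUnion_mul_sum_card_inter (s : Finset ι) (A : ι → Finset α) :
    (∑ i ∈ s, #(A i)) ^ 2 ≤ #(s.biUnion A) * ∑ i ∈ s, ∑ j ∈ s, #(A i ∩ A j) := by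
  have card_eq {B : Finset α} (hB : B ⊆ s.biUnion A) :
      #B = ∑ x ∈ s.biUnion A, if x ∈ B then 1 else 0 := by
    rw [sum_boole, filter_mem_eq_inter, inter_eq_right.2 hB, Nat.cast_id]
  have hsub {i : ι} (hi : i ∈ s) : A i ⊆ s.biUnion A := subset_biUnion_of_mem A hi
  let m (x : α) : ℕ := ∑ i ∈ s, if x ∈ A i then 1 else 0
  have sum_m : ∑ i ∈ s, #(A i) = ∑ x ∈ s.biUnion A, m x := by
    rw [sum_congr rfl fun i hi => card_eq (hsub hi), sum_comm]
  have sum_m_sq : ∑ i ∈ s, ∑ j ∈ s, #(A i ∩ A j) = ∑ x ∈ s.biUnion A, m x ^ 2 := by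
    calc ∑ i ∈ s, ∑ j ∈ s, #(A i ∩ A j)
        = ∑ i ∈ s, ∑ j ∈ s, ∑ x ∈ s.biUnion A,
            (if x ∈ A i then 1 else 0) * (if x ∈ A j then 1 else 0) := by
          refine sum_congr rfl fun i hi => sum_congr rfl fun j _ => ?_
          rw [card_eq (inter_subset_left.trans (hsub hi))]
          simp only [mem_inter, ite_and, ite_mul, one_mul, zero_mul]
      _ = ∑ x ∈ s.biUnion A, m x ^ 2 := by
          simp only [m, sq, sum_mul_sum]
          rw [sum_congr rfl fun i _ => sum_comm, sum_comm]
  rw [sum_m, sum_m_sq]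
  simpa using sum_mul_sq_le_sq_mul_sq (s.biUnion A) 1 m

theorem card_compl_biUnion_div_card_le [Fintype α] {s : Finset ι} {A : ι → Finset α} {a b : ℕ}
    (hs : s.Nonempty) (ha : 0 < a) (hA : ∀ i ∈ s, #(A i) = a)
    (hAA : ∀ i ∈ s, ∀ j ∈ s, i ≠ j → #(A i ∩ A j) ≤ b) :
    (#(s.biUnion A)ᶜ : ℝ) / Fintype.card α ≤
      1 - ((Fintype.card α : ℝ) / (#s * a) + Fintype.card α * b / a ^ 2)⁻¹ := by
  classical
  have sum_inter : ∑ i ∈ s, ∑ j ∈ s, #(A i ∩ A j) ≤ #s * a + #s ^ 2 * b := by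
    calc ∑ i ∈ s, ∑ j ∈ s, #(A i ∩ A j)
        ≤ ∑ i ∈ s, ∑ j ∈ s, ((if i = j then a else 0) + b) := by
          refine sum_le_sum fun i hi => sum_le_sum fun j hj => ?_
          rcases eq_or_ne i j with rfl | hij
          · simp [hA i hi]
          · simpa [hij] using hAA i hi j hj hij
      _ = #s * a + #s ^ 2 * b := by
          simp [sum_add_distrib, sq, mul_assoc]
  have chung_erdos : (#s * a : ℝ) ^ 2 ≤ #(s.biUnion A) * (#s * a + #s ^ 2 * b) := by
    have := sq_sum_card_le_card_biUnion_mul_sum_card_inter s A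
    rw [sum_congr rfl hA, sum_const, smul_eq_mul] at this
    exact_mod_cast this.trans (Nat.mul_le_mul_left _ sum_inter)
  obtain ⟨i, hi⟩ := hs
  have s_pos : (0 : ℝ) < #s := by exact_mod_cast card_pos.2 ⟨i, hi⟩
  have a_pos : (0 : ℝ) < a := by exact_mod_cast ha
  have card_pos : (0 : ℝ) < Fintype.card α :=
    a_pos.trans_le (by exact_mod_cast hA i hi ▸ card_le_univ (A i))
  have hcompl : (#(s.biUnion A)ᶜ : ℝ) = Fintype.card α - #(s.biUnion A) := by
    rw [card_compl, Nat.cast_sub (card_le_univ _)]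
  rw [hcompl, sub_div, div_self card_pos.ne']
  gcongr
  calc ((Fintype.card α : ℝ) / (#s * a) + Fintype.card α * b / a ^ 2)⁻¹
      = (#s * a : ℝ) ^ 2 / (#s * a + #s ^ 2 * b) / Fintype.card α := by
        field_simp
    _ ≤ #(s.biUnion A) / Fintype.card α := by
        gcongr
        exact (div_le_iff₀ (by positivity)).2 chung_erdos

end SecondMoment

section Catalan

theorem catalan_pos (n : ℕ) : 0 < catalan n :=
  pos_of_mul_pos_right (succ_mul_catalan_eq_centralBinom n ▸ n.centralBinom_pos) (Nat.zero_le _)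

theorem add_two_mul_catalan_succ (n : ℕ) :
    (n + 2) * catalan (n + 1) = 2 * (2 * n + 1) * catalan n := by
  refine Nat.eq_of_mul_eq_mul_left n.succ_pos ?_
  calc (n + 1) * ((n + 2) * catalan (n + 1))
      = (n + 1) * (n + 1).centralBinom := by rw [← succ_mul_catalan_eq_centralBinom]
    _ = 2 * (2 * n + 1) * n.centralBinom := n.succ_mul_centralBinom_succ
    _ = (n + 1) * (2 * (2 * n + 1) * catalan n) := by
        rw [← succ_mul_catalan_eq_centralBinom]; ring

theorem tendsto_catalan_succ_div_catalan :
    Tendsto (fun n : ℕ => (catalan (n + 1) : ℝ) / catalan n) atTop (nhds 4) := by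
  have ratio_eq (n : ℕ) : (catalan (n + 1) : ℝ) / catalan n = 4 - 6 / ((n + 2 : ℕ) : ℝ) := by
    have hc : (catalan n : ℝ) ≠ 0 := by exact_mod_cast (catalan_pos n).ne'
    have hrec : ((n : ℝ) + 2) * catalan (n + 1) = 2 * (2 * n + 1) * catalan n := by
      exact_mod_cast add_two_mul_catalan_succ n
    push_cast
    field_simp
    linear_combination hrec
  simp only [ratio_eq]
  simpa using ((tendsto_const_div_atTop_nhds_zero_nat (6 : ℝ)).comp
    (tendsto_add_atTop_nat 2)).const_sub 4

end Catalan

section Peaks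

theorem forall_take_append {α : Type*} {P : List α → Prop} {l m : List α} :
    (∀ k, P ((l ++ m).take k)) ↔ (∀ k, P (l.take k)) ∧ ∀ k, P (l ++ m.take k) := by
  refine ⟨fun h => ⟨fun k => ?_, fun k => ?_⟩, fun ⟨hl, hm⟩ k => ?_⟩
  · rw [List.take_eq_take_min]
    simpa [List.take_append] using h (min k l.length)
  · simpa [List.take_length_add_append] using h (l.length + k)
  · rcases le_total k l.length with hk | hk
    · rw [List.take_append_of_le_length hk]
      exact hl k
    · obtain ⟨m, rfl⟩ := Nat.exists_eq_add_of_le hk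
      rw [List.take_length_add_append]
      exact hm m

theorem forall_count_take_insert_peak {l r : List DyckStep} :
    (∀ k, ((l ++ U :: D :: r).take k).count D ≤ ((l ++ U :: D :: r).take k).count U) ↔
      ∀ k, ((l ++ r).take k).count D ≤ ((l ++ r).take k).count U := by
  rw [forall_take_append (P := fun m => m.count D ≤ m.count U),
    forall_take_append (P := fun m => m.count D ≤ m.count U)]
  refine and_congr_right fun h => ?_
  have hl : l.count D ≤ l.count U := by simpa using h l.length
  rw [← Nat.and_forall_add_one, ← Nat.and_forall_add_one]
  simp [← add_assoc, hl, Nat.le_succ_of_le hl]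

/-- The word `p` has a peak at position `i`: its letters at `i` and `i + 1`, counted from `0`, are
an opening and a closing parenthesis. -/
def IsPeak (p : DyckWord) (i : ℕ) : Prop :=
  p.toList[i]? = some U ∧ p.toList[i + 1]? = some D

theorem isPeak_iff_exists_append {p : DyckWord} {i : ℕ} :
    IsPeak p i ↔ ∃ l r, p.toList = l ++ U :: D :: r ∧ i = l.length := by
  constructor
  · rintro ⟨hU, hD⟩
    obtain ⟨hi, hU⟩ := List.getElem?_eq_some_iff.1 hU
    obtain ⟨hi', hD⟩ := List.getElem?_eq_some_iff.1 hD
    refine ⟨p.toList.take i, p.toList.drop (i + 2), ?_, (List.length_take_of_le hi.le).symm⟩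
    rw [← hU, ← hD, ← List.drop_eq_getElem_cons, ← List.drop_eq_getElem_cons, List.take_append_drop]
  · rintro ⟨l, r, h, rfl⟩
    simp [IsPeak, h]

theorem isPeak_iff_parenMatched {p : DyckWord} {i : ℕ} :
    IsPeak p i ↔ ParenMatched p i (i + 1) := by
  rw [isPeak_iff_exists_append]
  constructor
  · rintro ⟨l, r, h, hi⟩
    have hnest : (0 : DyckWord).nest.toList = [U, D] := rfl
    exact ⟨l, r, 0, by simp [h, hnest], hi, rfl⟩
  · rintro ⟨l, r, q, h, hi, hj⟩
    have hq : q.toList = [] := List.length_eq_zero_iff.1 (by omega)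
    exact ⟨l, r, by simp [h, DyckWord.nest, hq], hi⟩

theorem IsPeak.not_isPeak_succ {p : DyckWord} {i : ℕ} (h : IsPeak p i) : ¬ IsPeak p (i + 1) := by
  intro h'
  simpa using h.2.symm.trans h'.1

/-- The word obtained from `p` by inserting a peak so that it starts at position `i`; for
`i` beyond the length of `p`, the peak is appended at the end. -/
def insertPeak (i : ℕ) (p : DyckWord) : DyckWord where
  toList := p.toList.take i ++ U :: D :: p.toList.drop i
  count_U_eq_count_D := by
    have := p.count_U_eq_count_D
    rw [← List.take_append_drop i p.toList, List.count_append, List.count_append] at this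
    simpa [← add_assoc] using this
  count_D_le_count_U := forall_count_take_insert_peak.2 <| by
    rw [List.take_append_drop]
    exact p.count_D_le_count_U

theorem semilength_insertPeak (i : ℕ) (p : DyckWord) :
    (insertPeak i p).semilength = p.semilength + 1 := by
  have hlen : (insertPeak i p).toList.length = p.toList.length + 2 := by
    simp only [insertPeak, List.length_append, List.length_cons, List.length_take,
      List.length_drop]
    omega
  have := (insertPeak i p).two_mul_semilength_eq_length
  have := p.two_mul_semilength_eq_length
  omega

theorem insertPeak_injOn (i s : ℕ) : Set.InjOn (insertPeak i) {p | p.semilength = s} := by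
  intro p hp q hq h
  have hlen : p.toList.length = q.toList.length := by
    rw [← p.two_mul_semilength_eq_length, ← q.two_mul_semilength_eq_length, hp, hq]
  obtain ⟨htake, hdrop⟩ := List.append_inj (congrArg DyckWord.toList h) (by simp [hlen])
  simp only [List.cons.injEq, true_and] at hdrop
  ext1
  rw [← List.take_append_drop i p.toList, htake, hdrop, List.take_append_drop]

theorem isPeak_insertPeak_self {p : DyckWord} {i : ℕ} (hi : i ≤ 2 * p.semilength) :
    IsPeak (insertPeak i p) i :=
  isPeak_iff_exists_append.2 ⟨_, _, rfl,
    (List.length_take_of_le (p.two_mul_semilength_eq_length ▸ hi)).symm⟩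

theorem isPeak_insertPeak_iff_of_lt {p : DyckWord} {i j : ℕ} (hij : i + 1 < j)
    (hj : j ≤ 2 * p.semilength) : IsPeak (insertPeak j p) i ↔ IsPeak p i := by
  have hlen : (p.toList.take j).length = j :=
    List.length_take_of_le (p.two_mul_semilength_eq_length ▸ hj)
  have getElem?_eq {k : ℕ} (hk : k < j) : (insertPeak j p).toList[k]? = p.toList[k]? := by
    simp only [insertPeak]
    rw [List.getElem?_append_left (hlen.symm ▸ hk), List.getElem?_take_of_lt hk]
  rw [IsPeak, IsPeak, getElem?_eq hij, getElem?_eq (by omega)]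

theorem IsPeak.exists_insertPeak_eq {p : DyckWord} {i : ℕ} (h : IsPeak p i) :
    ∃ q, insertPeak i q = p := by
  obtain ⟨l, r, hp, rfl⟩ := isPeak_iff_exists_append.1 h
  have hcount := p.count_U_eq_count_D
  have hprefix := p.count_D_le_count_U
  rw [hp] at hcount hprefix
  refine ⟨⟨l ++ r, ?_, forall_count_take_insert_peak.1 hprefix⟩, ?_⟩
  · simpa [List.count_append, ← add_assoc] using hcount
  · simp [insertPeak, DyckWord.ext_iff, hp]

end Peaks

/-- The `p`-strings of length `s`, that is, with `s` pairs of parentheses. -/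
abbrev ParenString (s : ℕ) : Type := {p : DyckWord // p.semilength = s}

namespace ParenString

/-- Insertion of a peak at position `i`, as a map between strings of fixed lengths. -/
def insertPeakEmbedding (s i : ℕ) : ParenString s ↪ ParenString (s + 1) where
  toFun p := ⟨insertPeak i p, by rw [semilength_insertPeak, p.2]⟩
  inj' p q h := Subtype.ext (insertPeak_injOn i s p.2 q.2 (congrArg Subtype.val h))

open scoped Classical in
/-- The `p`-strings of length `s` with a peak at position `i`. -/
noncomputable def withPeak (s i : ℕ) : Finset (ParenString s) := {p | IsPeak p i}

theorem mem_withPeak {s i : ℕ} {p : ParenString s} : p ∈ withPeak s i ↔ IsPeak p i := by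
  simp [withPeak]

theorem mem_withPeak_iff_exists {s i : ℕ} (hi : i ≤ 2 * s) {p : ParenString (s + 1)} :
    p ∈ withPeak (s + 1) i ↔ ∃ q, insertPeakEmbedding s i q = p := by
  rw [mem_withPeak]
  constructor
  · intro h
    obtain ⟨q, hq⟩ := h.exists_insertPeak_eq
    have hs : q.semilength = s := by
      simpa [← hq, semilength_insertPeak] using p.2
    exact ⟨⟨q, hs⟩, Subtype.ext hq⟩
  · rintro ⟨q, rfl⟩
    exact isPeak_insertPeak_self (q.2.symm ▸ hi)

theorem withPeak_succ_eq_map {s i : ℕ} (hi : i ≤ 2 * s) :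
    withPeak (s + 1) i = univ.map (insertPeakEmbedding s i) := by
  ext p
  simp [mem_withPeak_iff_exists hi]

theorem withPeak_inter_withPeak_eq_map {s i j : ℕ} (hij : i + 1 < j) (hj : j ≤ 2 * s) :
    withPeak (s + 1) i ∩ withPeak (s + 1) j = (withPeak s i).map (insertPeakEmbedding s j) := by
  have isPeak_iff (q : ParenString s) : IsPeak (insertPeakEmbedding s j q) i ↔ IsPeak q i :=
    isPeak_insertPeak_iff_of_lt hij (q.2.symm ▸ hj)
  ext p
  rw [mem_inter, mem_withPeak_iff_exists hj, mem_withPeak, Finset.mem_map]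
  constructor
  · rintro ⟨hp, q, rfl⟩
    exact ⟨q, mem_withPeak.2 ((isPeak_iff q).1 hp), rfl⟩
  · rintro ⟨q, hq, rfl⟩
    exact ⟨(isPeak_iff q).2 (mem_withPeak.1 hq), q, rfl⟩

theorem card_withPeak {s i : ℕ} (hi : i ≤ 2 * s) : #(withPeak (s + 1) i) = catalan s := by
  rw [withPeak_succ_eq_map hi, card_map, card_univ, DyckWord.card_dyckWord_semilength_eq_catalan]

theorem card_withPeak_inter_withPeak {s i j : ℕ} (hij : i + 1 < j) (hj : j ≤ 2 * (s + 1)) :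
    #(withPeak (s + 2) i ∩ withPeak (s + 2) j) = catalan s := by
  rw [withPeak_inter_withPeak_eq_map hij hj, card_map, card_withPeak (by omega)]

theorem disjoint_withPeak_succ (s i : ℕ) : Disjoint (withPeak s i) (withPeak s (i + 1)) :=
  disjoint_left.2 fun _ h h' => (mem_withPeak.1 h).not_isPeak_succ (mem_withPeak.1 h')

theorem card_withPeak_inter_withPeak_le {s i j : ℕ} (hij : i < j) (hj : j ≤ 2 * (s + 1)) :
    #(withPeak (s + 2) i ∩ withPeak (s + 2) j) ≤ catalan s := by
  rcases (Nat.succ_le_of_lt hij).eq_or_lt with rfl | hij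
  · simp [disjoint_iff_inter_eq_empty.1 (disjoint_withPeak_succ _ _)]
  · exact (card_withPeak_inter_withPeak hij hj).le

end ParenString

section MatchedPairs

@[elab_as_elim]
theorem dyckWord_induction {motive : DyckWord → Prop} (zero : motive 0)
    (nest_add : ∀ p q, motive p → motive q → motive (p.nest + q)) (p : DyckWord) : motive p := by
  by_cases hp : p = 0
  · exact hp ▸ zero
  · rw [← DyckWord.nest_insidePart_add_outsidePart hp]
    have := DyckWord.semilength_insidePart_lt hp
    have := DyckWord.semilength_outsidePart_lt hp
    exact nest_add _ _ (dyckWord_induction zero nest_add _) (dyckWord_induction zero nest_add _)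
termination_by p.semilength

theorem toList_nest_add (p q : DyckWord) :
    (p.nest + q).toList = U :: (p.toList ++ D :: q.toList) := by
  change p.nest.toList ++ q.toList = _
  simp [DyckWord.nest]

theorem ParenMatched.of_toList_eq_append {p q : DyckWord} {l r : List DyckStep} {i j : ℕ}
    (h : ParenMatched q i j) (hp : p.toList = l ++ q.toList ++ r) :
    ParenMatched p (l.length + i) (l.length + j) := by
  obtain ⟨l', r', w, hq, rfl, rfl⟩ := h
  exact ⟨l ++ l', r' ++ r, w, by simp [hp, hq], by simp, by simp [add_assoc]⟩

theorem getElem?_toList_eq_U_iff_exists_parenMatched {p : DyckWord} {i : ℕ} :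
    p.toList[i]? = some U ↔ ∃ j, ParenMatched p i j := by
  refine ⟨fun h => ?_, ?_⟩
  · induction p using dyckWord_induction generalizing i with
    | zero => simp [DyckWord.toList_eq_nil.2] at h
    | nest_add p q ihp ihq =>
      rcases i with _ | i
      · exact ⟨_, [], q.toList, p, rfl, rfl, rfl⟩
      rw [toList_nest_add, List.getElem?_cons_succ] at h
      rcases lt_trichotomy i p.toList.length with hi | hi | hi
      · rw [List.getElem?_append_left hi] at h
        obtain ⟨j, hj⟩ := ihp h
        have := hj.of_toList_eq_append (l := [U]) (r := D :: q.toList) (toList_nest_add p q)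
        exact ⟨_, by simpa [add_comm] using this⟩
      · simp [hi] at h
      · obtain ⟨k, rfl⟩ := Nat.exists_eq_add_of_lt hi
        rw [add_assoc, List.getElem?_append_right (Nat.le_add_right _ _),
          Nat.add_sub_cancel_left, List.getElem?_cons_succ] at h
        obtain ⟨j, hj⟩ := ihq h
        have := hj.of_toList_eq_append (p := p.nest + q) (l := U :: (p.toList ++ [D])) (r := [])
          (by simp [toList_nest_add])
        exact ⟨_, by simpa [add_right_comm] using this⟩
  · rintro ⟨j, l, r, q, h, rfl, -⟩
    simp [h, DyckWord.nest]

theorem eq_of_forall_parenMatched_iff {p q : DyckWord} (hs : p.semilength = q.semilength)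
    (h : ∀ i j, ParenMatched p i j ↔ ParenMatched q i j) : p = q := by
  have hU (i : ℕ) : p.toList[i]? = some U ↔ q.toList[i]? = some U := by
    simp only [getElem?_toList_eq_U_iff_exists_parenMatched, h]
  have hlen : p.toList.length = q.toList.length := by
    rw [← p.two_mul_semilength_eq_length, ← q.two_mul_semilength_eq_length, hs]
  refine DyckWord.ext (List.ext_getElem hlen fun i hp hq => ?_)
  have := hU i
  rw [List.getElem?_eq_getElem hp, List.getElem?_eq_getElem hq] at this
  rcases p.toList[i].dichotomy with hpi | hpi <;> rcases q.toList[i].dichotomy with hqi | hqi <;>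
    simp_all

end MatchedPairs

section MeanderGraphs

theorem isEdgeOf_iff_exists_isLink {s : ℕ} {P Q : ParenString s} {e : MeanderEdge} :
    e.IsEdgeOf s P Q ↔ ∃ x y, (meanderGraph s P Q).IsLink e x y := by
  refine ⟨fun h => ?_, fun ⟨_, _, h⟩ => h.1⟩
  obtain ⟨⟨x, y⟩, hxy⟩ := Sym2.mk_surjective (e.ends s)
  exact ⟨x, y, h, hxy⟩

theorem meanderGraph_injective (s : ℕ) :
    Function.Injective fun x : ParenString s × ParenString s => meanderGraph s x.1 x.2 := by
  rintro ⟨P, Q⟩ ⟨P', Q'⟩ h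
  have hE (e : MeanderEdge) : e.IsEdgeOf s P Q ↔ e.IsEdgeOf s P' Q' := by
    simp only at h
    rw [isEdgeOf_iff_exists_isLink, h, isEdgeOf_iff_exists_isLink]
  refine Prod.ext (Subtype.ext ?_) (Subtype.ext ?_)
  · refine eq_of_forall_parenMatched_iff (P.2.trans P'.2.symm) fun i j => ?_
    simpa [MeanderEdge.IsEdgeOf] using hE (.upper (i + 1) (j + 1))
  · exact eq_of_forall_parenMatched_iff (Q.2.trans Q'.2.symm) fun i j => hE (.lower i j)

theorem meanderGraphs_eq_range (s : ℕ) : meanderGraphs s =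
    Set.range fun x : ParenString s × ParenString s => meanderGraph s x.1 x.2 := by
  ext Γ
  simp [meanderGraphs, eq_comm]

theorem card_parenString_prod (s : ℕ) :
    Fintype.card (ParenString s × ParenString s) = catalan s ^ 2 := by
  rw [Fintype.card_prod, DyckWord.card_dyckWord_semilength_eq_catalan, sq]

theorem ncard_meanderGraphs (s : ℕ) : (meanderGraphs s).ncard = catalan s ^ 2 := by
  rw [meanderGraphs_eq_range, ← Set.image_univ,
    Set.ncard_image_of_injective _ (meanderGraph_injective s), Set.ncard_univ,
    Nat.card_eq_fintype_card, card_parenString_prod]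

theorem hasPiercedCircleAt_succ_of_isPeak {s i : ℕ} {P Q : ParenString s}
    (hP : IsPeak P i) (hQ : IsPeak Q (i + 1)) :
    HasPiercedCircleAt (meanderGraph s P Q) (i + 1) := by
  have hi : i + 2 < 2 * s := by
    rw [← Q.2, DyckWord.two_mul_semilength_eq_length]
    exact (List.getElem?_eq_some_iff.1 hQ.2).1
  have left_vertex : MeanderEdge.toVertex s (i + 1) = i + 1 := by
    unfold MeanderEdge.toVertex; omega
  have right_vertex : MeanderEdge.toVertex s (i + 1 + 1) = i + 1 + 1 := by
    unfold MeanderEdge.toVertex; omega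
  refine ⟨⟨⟨i, i + 1, isPeak_iff_parenMatched.1 hP, rfl, rfl⟩, ?_⟩,
    ⟨isPeak_iff_parenMatched.1 hQ, ?_⟩⟩ <;>
  simp only [MeanderEdge.ends, left_vertex, right_vertex]

theorem finite_setOf_hasPiercedCircleAt {s : ℕ} (P Q : ParenString s) :
    {i | HasPiercedCircleAt (meanderGraph s P Q) i}.Finite :=
  (Set.finite_lt_nat (2 * s)).subset fun _ hi => hi.1.left_mem.2

open ParenString

theorem meanderE_zero_le (s n : ℕ) : meanderE s 0 ≤
    #((range n).biUnion fun i => withPeak s i ×ˢ withPeak s (i + 1))ᶜ := by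
  rw [← Set.ncard_coe_finset]
  refine (Set.ncard_le_ncard ?_ ((finite_toSet _).image _)).trans
    (Set.ncard_image_le (f := fun x => meanderGraph s x.1 x.2) (finite_toSet _))
  rintro Γ ⟨⟨P, Q, rfl⟩, h0⟩
  rw [numPiercedCircles, Set.ncard_eq_zero (finite_setOf_hasPiercedCircleAt P Q)] at h0
  refine ⟨(P, Q), ?_, rfl⟩
  simp only [mem_coe, mem_compl, mem_biUnion, mem_product, mem_withPeak]
  rintro ⟨i, -, hP, hQ⟩
  exact Set.eq_empty_iff_forall_notMem.1 h0 (i + 1) (hasPiercedCircleAt_succ_of_isPeak hP hQ)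

theorem card_withPeak_prod_inter_le {t i j : ℕ} (hi : i < 2 * t + 2) (hj : j < 2 * t + 2)
    (hij : i ≠ j) :
    #((withPeak (t + 2) i ×ˢ withPeak (t + 2) (i + 1)) ∩
      (withPeak (t + 2) j ×ˢ withPeak (t + 2) (j + 1))) ≤ catalan t ^ 2 := by
  wlog hlt : i < j generalizing i j
  · rw [inter_comm]
    exact this hj hi hij.symm (by omega)
  rw [product_inter_product, card_product, sq]
  exact Nat.mul_le_mul (card_withPeak_inter_withPeak_le hlt (by omega))
    (card_withPeak_inter_withPeak_le (by omega) (by omega))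

theorem meanderE_zero_div_catalan_sq_le (t : ℕ) :
    (meanderE (t + 2) 0 : ℝ) / (catalan (t + 2) : ℝ) ^ 2 ≤
      1 - (((catalan (t + 2) : ℝ) / catalan (t + 1)) ^ 2 / ((2 * t + 2 : ℕ) : ℝ) +
        ((catalan (t + 2) / catalan (t + 1)) / (catalan (t + 1) / catalan t)) ^ 2)⁻¹ := by
  have hcard (i : ℕ) (hi : i ∈ range (2 * t + 2)) :
      #(withPeak (t + 2) i ×ˢ withPeak (t + 2) (i + 1)) = catalan (t + 1) ^ 2 := by
    have := mem_range.1 hi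
    rw [card_product, card_withPeak (by omega), card_withPeak (by omega), sq]
  have second_moment := card_compl_biUnion_div_card_le (nonempty_range_iff.2 (by omega))
    (pow_pos (catalan_pos (t + 1)) 2) hcard fun i hi j hj hij =>
      card_withPeak_prod_inter_le (mem_range.1 hi) (mem_range.1 hj) hij
  rw [card_parenString_prod, card_range] at second_moment
  calc (meanderE (t + 2) 0 : ℝ) / (catalan (t + 2) : ℝ) ^ 2
      ≤ _ / ((catalan (t + 2) ^ 2 : ℕ) : ℝ) := by
        push_cast
        gcongr
        exact meanderE_zero_le (t + 2) (2 * t + 2)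
    _ ≤ _ := second_moment
    _ = _ := by push_cast; field_simp

end MeanderGraphs

theorem proposition4p3 :
    Filter.Tendsto (fun s : ℕ => (meanderE s 0 : ℝ) / ((meanderGraphs s).ncard : ℝ))
        Filter.atTop (nhds 0) ∧
      Filter.Tendsto (fun s : ℕ => (meanderE s 0 : ℝ) / (catalan s : ℝ) ^ 2)
        Filter.atTop (nhds 0) := by
  have density : Tendsto (fun s : ℕ => (meanderE s 0 : ℝ) / (catalan s : ℝ) ^ 2)
      atTop (nhds 0) := by
    rw [← tendsto_add_atTop_iff_nat 2]
    have ratio := tendsto_catalan_succ_div_catalan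
    have ratio_succ := ratio.comp (tendsto_add_atTop_nat 1)
    have positions : Tendsto (fun t : ℕ => ((2 * t + 2 : ℕ) : ℝ)) atTop atTop :=
      tendsto_natCast_atTop_atTop.comp
        (tendsto_atTop_mono (fun t => show t ≤ 2 * t + 2 by omega) tendsto_id)
    have bound := (((ratio_succ.pow 2).div_atTop positions).add
      ((ratio_succ.div ratio four_ne_zero).pow 2)).inv₀ (by norm_num) |>.const_sub 1
    norm_num only at bound
    exact squeeze_zero (fun t => by positivity) meanderE_zero_div_catalan_sq_le bound
  refine ⟨?_, density⟩
  simpa only [ncard_meanderGraphs, Nat.cast_pow] using density
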